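/- For a finite simple graph $G=(V,E)$ and a map $\mathbf p:V\to\mathbb R^d$, the rigidity matrix $\mathsf R(G,\mathbf p)\in\mathbb R^{|E|\times d|V|}$ has one row for each edge $\{u,v\}$; this row equals $\mathbf p(u)-\mathbf p(v)$ on the $d$ coordinates of $u$, $\mathbf p(v)-\mathbf p(u)$ on the $d$ coordinates of $v$, and $0$ elsewhere. A graph $G$ with at least $d+1$ vertices is called $d$-rigid if there is a map $\mathbf p:V\to\mathbb R^d$ for which $\operatorname{rank}\mathsf R(G,\mathbf p)=d|V|-\binom{d+1}{2}$. A $d$-rigid component of $G$ is a maximal $d$-rigid induced subgraph, that is, an induced subgraph $G[U]$ that is $d$-rigid while $G[U']$ is not $d$-rigid for any $U\subsetneq U'\subseteq V$. Let $G(n,p)$ be the random graph on $n$ labelled vertices in which each pair of vertices is an edge independently with probability $p$. **Theorem (giant rigid component).** For every $\varepsilon\in(0,1)$ there exists $C>0$ such that for every fixed integer $d\ge 2$, the probability that $G\sim G(n,Cd\log d/n)$ contains a $d$-rigid component with at least $(1-\varepsilon)n$ vertices tends to $1$ as $n\to\infty$ (here $\log$ is the natural logarithm, and $n\ge Cd\log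 d$, so that the edge probability is at most $1$). -/

import Mathlib

namespace RigidComponent

open Classical in
/-- The rigidity matrix of the framework `(G, p)` in `ℝ^d`. The row of the edge `{u, v}` is
`p u - p v` on the `d` coordinates of `u`, `p v - p u` on those of `v`, and zero elsewhere. -/
noncomputable def rigidityMatrix {V : Type*} (d : ℕ) (G : SimpleGraph V) (p : V → Fin d → ℝ) :
    Matrix G.edgeSet (V × Fin d) ℝ :=
  Matrix.of fun e x =>
    Sym2.lift ⟨fun u v =>
      (if x.1 = u then p u x.2 - p v x.2 else 0) + (if x.1 = v then p v x.2 - p u x.2 else 0),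
      fun _ _ => add_comm _ _⟩ e.1

/-- The framework `(G, p)` is infinitesimally rigid: its rigidity matrix has rank
`d |V| - (d + 1).choose 2`, the largest possible value when `|V| ≥ d + 1`. -/
def IsInfinitesimallyRigid {V : Type*} [Fintype V] (d : ℕ) (G : SimpleGraph V)
    (p : V → Fin d → ℝ) : Prop :=
  (rigidityMatrix d G p).rank + (d + 1).choose 2 = d * Fintype.card V

/-- A finite graph on at least `d + 1` vertices is `d`-rigid if some embedding of its vertices
into `ℝ^d` gives an infinitesimally rigid framework. -/
def IsRigid {V : Type*} [Fintype V] (d : ℕ) (G : SimpleGraph V) : Prop :=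
  d + 1 ≤ Fintype.card V ∧ ∃ p : V → Fin d → ℝ, IsInfinitesimallyRigid d G p

/-- `G[U]` is a `d`-rigid component of `G`: a maximal `d`-rigid induced subgraph. -/
def IsRigidComponent {V : Type*} (d : ℕ) (G : SimpleGraph V) (U : Finset V) : Prop :=
  IsRigid d (G.induce (U : Set V)) ∧
    ∀ U' : Finset V, U ⊂ U' → ¬ IsRigid d (G.induce (U' : Set V))

end RigidComponent

/-! ### Rigidity from connected colourings. -/

namespace RigidComponent

open Filter Topology

/-! Place each colour class on its own coordinate axis, near the unit vector. In the limit where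
each class collapses to that vector, with the edges inside classes rescaled, the equations of an
infinitesimal motion `x` say that `x (·, i) - x (·, j)` is preserved by edges between classes `i`
and `j`, and `x (·, i)` by edges inside class `i`. If these graphs are all connected, at most `(d +
1).choose 2` free parameters remain. Rank is lower semicontinuous, so nearby genuine frameworks are
rigid (`IsConnectedColoring.isRigid`).

In the random graph, take `d` disjoint blocks of `m = n / d` vertices and delete a largest detached
set `D` of fewer than `2k` vertices. If any two large sets are joined and no detached set has size
in `[2k, 4k]`, what remains is connected between every two blocks
(`exists_detached_forall_isClosedBetween`). Union bounds show that both conditions hold with high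
probability once `p * m` is a large multiple of `log d`. -/

/-- Every set of vertices that no edge between the colour classes `i` and `j` leaves or enters
contains all or none of these two classes: for `i ≠ j` the bipartite graph between the classes is
connected, and for `i = j` the graph induced on the class is connected. -/
def IsConnectedColoring {V : Type*} {d : ℕ} (G : SimpleGraph V) (c : V → Fin d) : Prop :=
  ∀ (i j : Fin d) (S : Set V), (∀ u v, G.Adj u v → c u = i → c v = j → (u ∈ S ↔ v ∈ S)) →
    ∀ u v, (c u = i ∨ c u = j) → (c v = i ∨ c v = j) → u ∈ S → v ∈ S

theorem IsConnectedColoring.eq_of_adj {V : Type*} {d : ℕ} {G : SimpleGraph V} {c : V → Fin d}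
    (h : IsConnectedColoring G c) {α : Type*} {i j : Fin d} (f : V → α)
    (hf : ∀ u v, G.Adj u v → c u = i → c v = j → f u = f v) {u v : V}
    (hu : c u = i ∨ c u = j) (hv : c v = i ∨ c v = j) : f u = f v := by
  have := h i j {w | f w = f u} (fun a b hab ha hb => by
    simp only [Set.mem_ofPred_eq]; rw [hf a b hab ha hb]) u v hu hv rfl
  exact this.symm

section Matrix

variable {V : Type*} {d : ℕ} {G : SimpleGraph V}

theorem rigidityMatrix_mulVec [Fintype V] (p : V → Fin d → ℝ) (x : V × Fin d → ℝ) {u v : V}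
    (h : G.Adj u v) :
    (rigidityMatrix d G p).mulVec x ⟨s(u, v), h⟩ =
      ∑ k, (p u k - p v k) * (x (u, k) - x (v, k)) := by
  classical
  simp only [Matrix.mulVec, dotProduct, rigidityMatrix, Matrix.of_apply, Sym2.lift_mk,
    Fintype.sum_prod_type, add_mul, ite_mul, zero_mul, Finset.sum_add_distrib]
  rw [Finset.sum_comm, Finset.sum_comm (s := Finset.univ (α := V))]
  simp only [Finset.sum_ite_eq', Finset.mem_univ, if_true, ← Finset.sum_add_distrib]
  refine Finset.sum_congr rfl fun k _ => by ring

/-- The embedding that puts `u` at `a u` on the coordinate axis of its colour. -/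
def axisEmbedding (c : V → Fin d) (a : V → ℝ) : V → Fin d → ℝ :=
  fun u => Pi.single (c u) (a u)

theorem rigidityMatrix_axisEmbedding_mulVec [Fintype V] (c : V → Fin d) (a : V → ℝ)
    (x : V × Fin d → ℝ) {u v : V} (h : G.Adj u v) :
    (rigidityMatrix d G (axisEmbedding c a)).mulVec x ⟨s(u, v), h⟩ =
      a u * (x (u, c u) - x (v, c u)) - a v * (x (u, c v) - x (v, c v)) := by
  rw [rigidityMatrix_mulVec]
  simp [axisEmbedding, Pi.single_apply, sub_mul, Finset.sum_sub_distrib]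

/-- The skew-symmetric matrix with off-diagonal entries given by `w`. -/
def skew (w : Sym2 (Fin d) → ℝ) (k l : Fin d) : ℝ :=
  if k < l then w s(k, l) else if l < k then -w s(k, l) else 0

theorem skew_add_skew (w : Sym2 (Fin d) → ℝ) (k l : Fin d) : skew w k l + skew w l k = 0 := by
  rcases lt_trichotomy k l with h | h | h
  · simp [skew, h, h.not_gt, Sym2.eq_swap (a := l)]
  · simp [skew, h]
  · simp [skew, h, h.not_gt, Sym2.eq_swap (a := l)]

theorem skew_self (w : Sym2 (Fin d) → ℝ) (k : Fin d) : skew w k k = 0 := by simp [skew]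

/-- The infinitesimal isometries restricted to an embedding on the coordinate axes. -/
def trivialMotion (c : V → Fin d) (a : V → ℝ) :
    (Sym2 (Fin d) → ℝ) →ₗ[ℝ] (V × Fin d → ℝ) where
  toFun w := fun x => w s(x.2, x.2) + a x.1 * skew w x.2 (c x.1)
  map_add' w w' := by
    ext x
    simp only [skew, Pi.add_apply]
    split_ifs <;> ring
  map_smul' r w := by
    ext x
    simp only [skew, Pi.smul_apply, smul_eq_mul, RingHom.id_apply]
    split_ifs <;> ring

theorem trivialMotion_injective {c : V → Fin d} (hc : Function.Surjective c) {a : V → ℝ}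
    (ha : ∀ u, a u ≠ 0) : Function.Injective (trivialMotion c a) := by
  rw [← LinearMap.ker_eq_bot, LinearMap.ker_eq_bot']
  intro w hw
  have h (u : V) (k : Fin d) : w s(k, k) + a u * skew w k (c u) = 0 := congrFun hw (u, k)
  have hdiag (k : Fin d) : w s(k, k) = 0 := by
    obtain ⟨u, rfl⟩ := hc k
    simpa [skew_self] using h u (c u)
  have hskew (k l : Fin d) : skew w k l = 0 := by
    obtain ⟨u, rfl⟩ := hc l
    simpa [hdiag, ha u] using h u k
  ext z
  induction z with
  | _ k l =>
    have := hskew k l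
    rcases lt_trichotomy k l with h' | rfl | h'
    · simpa [skew, h'] using this
    · exact hdiag k
    · simpa [skew, h', h'.not_gt] using this

theorem finrank_sym2_fin : Module.finrank ℝ (Sym2 (Fin d) → ℝ) = (d + 1).choose 2 := by
  simp [Sym2.card]

/-- The trivial motions lie in the kernel: diagonal pairs parametrise translations, the others
rotations. They are independent since every axis carries a nonzero point. -/
theorem rank_rigidityMatrix_axisEmbedding_le [Fintype V] {c : V → Fin d}
    (hc : Function.Surjective c) {a : V → ℝ} (ha : ∀ u, a u ≠ 0) :
    (rigidityMatrix d G (axisEmbedding c a)).rank + (d + 1).choose 2 ≤ d * Fintype.card V := by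
  set R := rigidityMatrix d G (axisEmbedding c a)
  have hrange : LinearMap.range (trivialMotion c a) ≤ LinearMap.ker R.mulVecLin := by
    rintro _ ⟨w, rfl⟩
    rw [LinearMap.mem_ker]
    ext ⟨e, he⟩
    induction e with
    | _ u v =>
      rw [Matrix.mulVecLin_apply, rigidityMatrix_axisEmbedding_mulVec c a _ he]
      have := skew_add_skew w (c u) (c v)
      simp only [trivialMotion, LinearMap.coe_mk, AddHom.coe_mk, skew_self, Pi.zero_apply]
      linear_combination (-a u * a v) * this
  have h1 := LinearMap.finrank_range_of_inj (trivialMotion_injective hc ha)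
  have h2 := Submodule.finrank_mono hrange
  have h3 := R.mulVecLin.finrank_range_add_finrank_ker
  rw [h1, finrank_sym2_fin] at h2
  simp only [Module.finrank_fintype_fun_eq_card, Fintype.card_prod, Fintype.card_fin] at h3
  rw [Matrix.rank, mul_comm d]
  omega

open Classical in
/-- The rigidity matrix of the framework with `u` at `1 + t * s u` on the axis of its colour, where
the rows of the edges inside a colour class are divided by `t`. -/
noncomputable def scaledMatrix (G : SimpleGraph V) (c : V → Fin d) (s : V → ℝ) (t : ℝ) :
    Matrix G.edgeSet (V × Fin d) ℝ :=
  Matrix.of fun e x =>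
    if (e.1.map c).IsDiag then rigidityMatrix d G (axisEmbedding c s) e x
    else rigidityMatrix d G (axisEmbedding c fun u => 1 + t * s u) e x

theorem continuous_scaledMatrix (c : V → Fin d) (s : V → ℝ) :
    Continuous (scaledMatrix G c s) := by
  refine continuous_pi fun e => continuous_pi fun x => ?_
  obtain ⟨e, he⟩ := e
  induction e with
  | _ u v =>
    simp only [scaledMatrix, Matrix.of_apply, rigidityMatrix, Sym2.lift_mk, axisEmbedding,
      Pi.single_apply]
    split_ifs <;> fun_prop

/-- Inside a class `(1 + t * s u) - (1 + t * s v) = t * (s u - s v)`, so the scaled matrix is a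
diagonal matrix times the rigidity matrix. -/
theorem rank_scaledMatrix_le [Fintype V] (c : V → Fin d) (s : V → ℝ) {t : ℝ} (ht : t ≠ 0) :
    (scaledMatrix G c s t).rank ≤
      (rigidityMatrix d G (axisEmbedding c fun u => 1 + t * s u)).rank := by
  classical
  have : Fintype G.edgeSet := Fintype.ofFinite _
  have : scaledMatrix G c s t =
      Matrix.diagonal (fun e : G.edgeSet => if (e.1.map c).IsDiag then t⁻¹ else 1) *
        rigidityMatrix d G (axisEmbedding c fun u => 1 + t * s u) := by
    ext ⟨e, he⟩ x
    rw [Matrix.diagonal_mul]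
    simp only [scaledMatrix, Matrix.of_apply]
    split_ifs with h
    · induction e with
      | _ u v =>
        have h' : c u = c v := by simpa using h
        simp only [rigidityMatrix, Matrix.of_apply, Sym2.lift_mk, axisEmbedding, Pi.single_apply, h']
        split_ifs <;> field_simp <;> ring
    · simp
  rw [this]
  exact Matrix.rank_mul_le_right _ _

theorem scaledMatrix_zero_mulVec_of_ne [Fintype V] {c : V → Fin d} (s : V → ℝ)
    (x : V × Fin d → ℝ) {u v : V} (h : G.Adj u v) (hc : c u ≠ c v) :
    (scaledMatrix G c s 0).mulVec x ⟨s(u, v), h⟩ =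
      (x (u, c u) - x (v, c u)) - (x (u, c v) - x (v, c v)) := by
  have := rigidityMatrix_axisEmbedding_mulVec c (fun u => 1 + 0 * s u) x h
  simp only [zero_mul, add_zero, one_mul] at this
  rw [← this]
  simp [Matrix.mulVec, scaledMatrix, hc]

theorem scaledMatrix_zero_mulVec_of_eq [Fintype V] {c : V → Fin d} (s : V → ℝ)
    (x : V × Fin d → ℝ) {u v : V} (h : G.Adj u v) (hc : c u = c v) :
    (scaledMatrix G c s 0).mulVec x ⟨s(u, v), h⟩ =
      (s u - s v) * (x (u, c u) - x (v, c u)) := by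
  have := rigidityMatrix_axisEmbedding_mulVec c s x h
  rw [← hc, ← sub_mul] at this
  rw [← this]
  simp [Matrix.mulVec, scaledMatrix, hc]

/-- With a representative `r i` of each class, a kernel vector is determined by the entries `x (r i,
k)` with `i ≤ k`, one for each unordered pair of colours. -/
theorem le_rank_scaledMatrix_zero [Fintype V] {c : V → Fin d} (hc : Function.Surjective c)
    (hG : IsConnectedColoring G c) {s : V → ℝ} (hs : Function.Injective s) :
    d * Fintype.card V ≤ (scaledMatrix G c s 0).rank + (d + 1).choose 2 := by
  set M := scaledMatrix G c s 0
  choose r hr using hc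
  let φ : (V × Fin d → ℝ) →ₗ[ℝ] (Sym2 (Fin d) → ℝ) :=
    LinearMap.funLeft ℝ ℝ fun z : Sym2 (Fin d) => (r z.inf, z.sup)
  have key : ∀ x ∈ LinearMap.ker M.mulVecLin, φ x = 0 → x = 0 := by
    intro x hx hφ
    rw [LinearMap.mem_ker, Matrix.mulVecLin_apply] at hx
    have hedge {u v : V} (h : G.Adj u v) : M.mulVec x ⟨s(u, v), h⟩ = 0 := congrFun hx _
    have hij {i j : Fin d} (hne : i ≠ j) {u v : V} (hu : c u = i ∨ c u = j)
        (hv : c v = i ∨ c v = j) : x (u, i) - x (u, j) = x (v, i) - x (v, j) := by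
      refine hG.eq_of_adj (fun w => x (w, i) - x (w, j)) (fun a b hab ha hb => ?_) hu hv
      have := hedge hab
      rw [scaledMatrix_zero_mulVec_of_ne s x hab (by rwa [ha, hb]), ha, hb] at this
      linarith
    have hii {u v : V} (huv : c u = c v) : x (u, c u) = x (v, c u) := by
      refine hG.eq_of_adj (i := c u) (j := c u) (fun w => x (w, c u))
        (fun a b hab ha hb => ?_) (Or.inl rfl) (Or.inl huv.symm)
      have := hedge hab
      rw [scaledMatrix_zero_mulVec_of_eq s x hab (by rw [ha, hb]), ha] at this
      rcases mul_eq_zero.1 this with h | h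
      · exact absurd (hs (sub_eq_zero.1 h)) hab.ne
      · exact sub_eq_zero.1 h
    have hle {i k : Fin d} (hik : i ≤ k) : x (r i, k) = 0 := by
      have := congrFun hφ s(i, k)
      simpa [φ, LinearMap.funLeft_apply, hik] using this
    have hrep (i k : Fin d) : x (r i, k) = 0 := by
      rcases le_or_gt i k with h | h
      · exact hle h
      · have := hij h.ne' (u := r i) (v := r k) (Or.inl (hr i)) (Or.inr (hr k))
        have h1 := hle h.le
        have h2 := hle (le_refl i)
        have h3 := hle (le_refl k)
        linarith
    ext ⟨u, k⟩
    have h1 : x (u, c u) = x (r (c u), c u) := hii (hr _).symm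
    by_cases hk : k = c u
    · subst hk
      rw [h1, hrep]; rfl
    · have := hij (Ne.symm hk) (u := u) (v := r (c u)) (Or.inl rfl) (Or.inl (hr _))
      rw [hrep, hrep] at this
      rw [hrep] at h1
      simp only [Pi.zero_apply]
      linarith
  have hinj : Function.Injective (φ.domRestrict (LinearMap.ker M.mulVecLin)) := by
    rw [← LinearMap.ker_eq_bot, LinearMap.ker_eq_bot']
    rintro ⟨x, hx⟩ h
    exact Subtype.ext (key x hx h)
  have h1 := LinearMap.finrank_le_finrank_of_injective hinj
  rw [finrank_sym2_fin] at h1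
  have h3 := M.mulVecLin.finrank_range_add_finrank_ker
  simp only [Module.finrank_fintype_fun_eq_card, Fintype.card_prod, Fintype.card_fin] at h3
  rw [Matrix.rank, mul_comm d]
  omega

end Matrix

/-- Rows forming a basis of the row space at `t₀` stay independent nearby, as linear independence is
an open condition. -/
theorem eventually_rank_le {m n : Type*} [Finite m] [Fintype n] {M : ℝ → Matrix m n ℝ}
    (hM : Continuous M) (t₀ : ℝ) : ∀ᶠ t in 𝓝 t₀, (M t₀).rank ≤ (M t).rank := by
  have : Fintype m := Fintype.ofFinite m
  obtain ⟨f, hf, -, hli⟩ :=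
    Submodule.exists_fun_fin_finrank_span_eq ℝ (Set.range (M t₀).row)
  choose g hg using hf
  have hcont : Continuous fun t => (fun i => (M t).row (g i)) := by
    refine continuous_pi fun i => continuous_pi fun j => ?_
    exact (continuous_apply j).comp ((continuous_apply (g i)).comp hM)
  have hopen := (isOpen_setOfPred_linearIndependent (𝕜 := ℝ) (E := n → ℝ)
    (ι := Fin (Module.finrank ℝ (Submodule.span ℝ (Set.range (M t₀).row))))).preimage hcont
  have hmem : t₀ ∈ (fun t => (fun i => (M t).row (g i))) ⁻¹' {f | LinearIndependent ℝ f} := by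
    simp only [Set.mem_preimage, Set.mem_ofPred_eq, hg]
    exact hli
  filter_upwards [hopen.mem_nhds hmem] with t ht
  have hli' : LinearIndependent ℝ fun i => (M t).row (g i) := ht
  rw [Matrix.rank_eq_finrank_span_row, Matrix.rank_eq_finrank_span_row]
  have h1 := finrank_span_eq_card hli'
  rw [Fintype.card_fin] at h1
  rw [← h1]
  exact Submodule.finrank_mono (Submodule.span_mono (by rintro _ ⟨i, rfl⟩; exact ⟨g i, rfl⟩))

/-- A graph with a connected colouring in `d` colours, all of them used, is `d`-rigid. -/
theorem IsConnectedColoring.isRigid {V : Type*} [Fintype V] {d : ℕ} {G : SimpleGraph V}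
    {c : V → Fin d} (hG : IsConnectedColoring G c) (hc : Function.Surjective c)
    (hcard : d + 1 ≤ Fintype.card V) : IsRigid d G := by
  refine ⟨hcard, ?_⟩
  -- Injectivity keeps the equations inside classes nondegenerate; nonnegativity keeps `1 + t * s u`
  -- nonzero for `t > 0`.
  let s : V → ℝ := fun u => (Fintype.equivFin V u : ℕ)
  have hs : Function.Injective s := fun u v h => by
    simpa [s, Fin.val_inj] using h
  have hev := (eventually_rank_le (continuous_scaledMatrix (G := G) c s) 0).filter_mono
    (nhdsWithin_le_nhds (s := Set.Ioi 0))
  obtain ⟨t, hrank, ht⟩ := (hev.and self_mem_nhdsWithin).exists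
  have ht : 0 < t := ht
  refine ⟨axisEmbedding c fun u => 1 + t * s u, le_antisymm ?_ ?_⟩
  · exact rank_rigidityMatrix_axisEmbedding_le hc fun u => by positivity
  · refine (le_rank_scaledMatrix_zero hc hG hs).trans ?_
    gcongr
    exact hrank.trans (rank_scaledMatrix_le c s ht.ne')

end RigidComponent

/-! ### Deterministic conditions for a large rigid subgraph. -/

namespace RigidComponent

section Deterministic

variable {V : Type*} {d : ℕ}

/-- Any two disjoint sets of at least `k` vertices inside parts are joined by an edge. -/
def JoinsLargeSets (G : SimpleGraph V) (P : Fin d → Finset V) (k : ℕ) : Prop :=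
  ∀ i j, ∀ X ⊆ P i, ∀ Y ⊆ P j, Disjoint X Y → k ≤ X.card → k ≤ Y.card →
    ∃ u ∈ X, ∃ v ∈ Y, G.Adj u v

/-- Every vertex `v` of `D` has no neighbour outside `D` in the part `τ v`. -/
def IsDetached (G : SimpleGraph V) (P : Fin d → Finset V) (D : Finset V) (τ : V → Fin d) : Prop :=
  ∀ v ∈ D, ∀ w ∈ P (τ v), w ∉ D → ¬ G.Adj v w

/-- No edge between `P i \ D` and `P j \ D` joins `S` to its complement. -/
def IsClosedBetween (G : SimpleGraph V) (P : Fin d → Finset V) (D : Finset V) (i j : Fin d)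
    (S : Finset V) : Prop :=
  ∀ u ∈ P i, ∀ v ∈ P j, u ∉ D → v ∉ D → G.Adj u v → (u ∈ S ↔ v ∈ S)

variable {G : SimpleGraph V} {P : Fin d → Finset V} {m k : ℕ}

theorem IsClosedBetween.symm {D S : Finset V} {i j : Fin d} (h : IsClosedBetween G P D i j S) :
    IsClosedBetween G P D j i S :=
  fun u hu v hv huD hvD huv => (h v hv u hu hvD huD huv.symm).symm

variable [DecidableEq V]

theorem IsClosedBetween.compl {D S : Finset V} {i j : Fin d} (h : IsClosedBetween G P D i j S) :
    IsClosedBetween G P D i j (((P i ∪ P j) \ D) \ S) := by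
  intro u hu v hv huD hvD huv
  have := h u hu v hv huD hvD huv
  simp [hu, hv, huD, hvD, this]

/-- If `S` had `k` vertices in `P i`, fewer than `k` vertices of `P j \ D` would avoid `S`. Then `S`
is large in `P j` too, and by symmetry its complement has fewer than `2k` vertices, less than half.
-/
theorem IsClosedBetween.card_inter_lt (hP : ∀ i, (P i).card = m) (hkm : 8 * k ≤ m)
    (hjoin : JoinsLargeSets G P k) {D S : Finset V} (hD : D.card < 2 * k) {i j : Fin d}
    (hS : S ⊆ (P i ∪ P j) \ D) (hcl : IsClosedBetween G P D i j S)
    (hhalf : 2 * S.card ≤ ((P i ∪ P j) \ D).card) : (S ∩ P i).card < k := by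
  have hno {i j : Fin d} (hcl : IsClosedBetween G P D i j S) (hSD : Disjoint S D)
      (h : k ≤ (S ∩ P i).card) : ((P j \ D) \ S).card < k := by
    by_contra! h'
    obtain ⟨u, hu, v, hv, huv⟩ := hjoin i j (S ∩ P i) Finset.inter_subset_right ((P j \ D) \ S)
      (Finset.sdiff_subset.trans Finset.sdiff_subset)
      (by rw [Finset.disjoint_left]; intro a ha hb; simp_all) h h'
    simp only [Finset.mem_inter, Finset.mem_sdiff] at hu hv
    exact hv.2 ((hcl u hu.2 v hv.1.1 (Finset.disjoint_left.1 hSD hu.1) hv.1.2 huv).1 hu.1)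
  have hSD : Disjoint S D := Finset.disjoint_of_subset_left hS Finset.sdiff_disjoint
  by_contra! h
  have h1 := hno hcl hSD h
  have hj : m - D.card ≤ (P j \ D).card := by
    rw [← hP j]; exact Finset.le_card_sdiff _ _
  have hj' : (P j \ D).card ≤ ((P j \ D) \ S).card + (S ∩ P j).card := by
    rw [← Finset.card_sdiff_add_card_inter (P j \ D) S]
    refine Nat.add_le_add_left (Finset.card_le_card fun a ha => ?_) _
    simp_all
  have h2 := hno hcl.symm hSD (by omega : k ≤ (S ∩ P j).card)
  have h3 : (((P i ∪ P j) \ D) \ S).card ≤ ((P i \ D) \ S).card + ((P j \ D) \ S).card := by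
    refine (Finset.card_le_card ?_).trans (Finset.card_union_le _ _)
    intro a ha
    simp_all
  have h4 : (P j \ D).card ≤ ((P i ∪ P j) \ D).card :=
    Finset.card_le_card (Finset.sdiff_subset_sdiff Finset.subset_union_right le_rfl)
  have h5 := Finset.card_sdiff_add_card_eq_card hS
  omega

/-- A set that is detached and cannot be enlarged to a slightly larger detached set leaves a
connected partition. -/
theorem exists_detached_forall_isClosedBetween [Fintype V] [NeZero d]
    (hP : ∀ i, (P i).card = m) (hk : 0 < k)
    (hkm : 8 * k ≤ m) (hjoin : JoinsLargeSets G P k)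
    (hdet : ∀ D : Finset V, 2 * k ≤ D.card → D.card ≤ 4 * k → ∀ τ, ¬ IsDetached G P D τ) :
    ∃ D : Finset V, D.card < 2 * k ∧ ∀ i j, ∀ S ⊆ (P i ∪ P j) \ D, IsClosedBetween G P D i j S →
      S = ∅ ∨ S = (P i ∪ P j) \ D := by
  classical
  obtain ⟨D, hDmem, hDmax⟩ := Finset.exists_max_image
    (Finset.univ.filter fun D : Finset V => D.card < 2 * k ∧ ∃ τ, IsDetached G P D τ)
    Finset.card ⟨∅, Finset.mem_filter.2 ⟨Finset.mem_univ _, by simpa using hk, fun _ => 0,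
      fun v hv => by simp at hv⟩⟩
  simp only [Finset.mem_filter, Finset.mem_univ, true_and] at hDmem hDmax
  obtain ⟨hD, τ, hτ⟩ := hDmem
  refine ⟨D, hD, ?_⟩
  have small : ∀ i j, ∀ S ⊆ (P i ∪ P j) \ D, IsClosedBetween G P D i j S →
      2 * S.card ≤ ((P i ∪ P j) \ D).card → S = ∅ := by
    intro i j S hS hcl hhalf
    by_contra hne
    have hi := hcl.card_inter_lt hP hkm hjoin hD hS hhalf
    have hj := hcl.symm.card_inter_lt hP hkm hjoin hD (by rwa [Finset.union_comm])
      (by rwa [Finset.union_comm])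
    have hScard : S.card ≤ (S ∩ P i).card + (S ∩ P j).card := by
      refine (Finset.card_le_card ?_).trans (Finset.card_union_le _ _)
      intro a ha
      have := hS ha
      simp_all
    have hSD : Disjoint D S := (Finset.disjoint_of_subset_left hS Finset.sdiff_disjoint).symm
    have hpos : 0 < S.card := Finset.card_pos.2 (Finset.nonempty_iff_ne_empty.2 hne)
    have hcard := Finset.card_union_of_disjoint hSD
    -- A vertex of `S` in one part has all its neighbours in the other part inside `D ∪ S`.
    have hdet' : IsDetached G P (D ∪ S)
        (fun v => if v ∈ D then τ v else if v ∈ P i then j else i) := by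
      intro v hv w hw hwD hvw
      rw [Finset.mem_union, not_or] at hwD
      by_cases hvD : v ∈ D
      · simp only [hvD, if_true] at hw
        exact hτ v hvD w hw hwD.1 hvw
      · have hvS : v ∈ S := by simpa [hvD] using hv
        simp only [hvD, if_false] at hw
        split_ifs at hw with hvi
        · exact hwD.2 ((hcl v hvi w hw hvD hwD.1 hvw).1 hvS)
        · have hvj : v ∈ P j := by
            have := hS hvS
            simp_all
          exact hwD.2 ((hcl.symm v hvj w hw hvD hwD.1 hvw).1 hvS)
    -- Since `S` has fewer than `2k` vertices, `D ∪ S` either contradicts maximality or has a size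
    -- in the excluded window.
    by_cases hlt : (D ∪ S).card < 2 * k
    · have := hDmax _ ⟨hlt, _, hdet'⟩
      omega
    · exact hdet _ (by omega) (by omega) _ hdet'
  intro i j S hS hcl
  have hsplit := Finset.card_sdiff_add_card_eq_card hS
  by_cases h : 2 * S.card ≤ ((P i ∪ P j) \ D).card
  · exact Or.inl (small i j S hS hcl h)
  · right
    have := small i j _ Finset.sdiff_subset hcl.compl (by omega)
    exact hS.antisymm (Finset.sdiff_eq_empty_iff_subset.1 this)

theorem exists_isRigid_induce [Fintype V] (hd : 2 ≤ d)
    (hPd : Pairwise fun i j => Disjoint (P i) (P j))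
    (hP : ∀ i, (P i).card = m) (hk : 0 < k)
    (hkm : 8 * k ≤ m) (hjoin : JoinsLargeSets G P k)
    (hdet : ∀ D : Finset V, 2 * k ≤ D.card → D.card ≤ 4 * k → ∀ τ, ¬ IsDetached G P D τ) :
    ∃ U : Finset V, IsRigid d (G.induce (U : Set V)) ∧ d * m ≤ U.card + 2 * k := by
  classical
  have : NeZero d := ⟨by omega⟩
  obtain ⟨D, hD, hconn⟩ := exists_detached_forall_isClosedBetween hP hk hkm hjoin hdet
  have hcardP : (Finset.univ.biUnion P).card = d * m := by
    rw [Finset.card_biUnion fun i _ j _ hij => hPd hij]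
    simp [hP]
  let U := Finset.univ.biUnion P \ D
  have hU : d * m ≤ U.card + 2 * k := by
    have := Finset.le_card_sdiff D (Finset.univ.biUnion P)
    rw [hcardP] at this
    change d * m ≤ (Finset.univ.biUnion P \ D).card + 2 * k
    omega
  have hex (u : (U : Set V)) : ∃ i, u.1 ∈ P i := by
    have := u.2
    simp only [U, Finset.mem_coe, Finset.mem_sdiff, Finset.mem_biUnion, Finset.mem_univ,
      true_and] at this
    exact this.1
  choose c hc using hex
  have hcu (u : (U : Set V)) {i : Fin d} (hi : u.1 ∈ P i) : c u = i := by
    by_contra hne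
    exact Finset.disjoint_left.1 (hPd hne) (hc u) hi
  have hUD (u : (U : Set V)) : u.1 ∉ D := (Finset.mem_sdiff.1 u.2).2
  have hmem {v : V} {i : Fin d} (hv : v ∈ P i) (hvD : v ∉ D) : v ∈ (U : Set V) := by
    simp only [U, Finset.mem_coe, Finset.mem_sdiff, Finset.mem_biUnion, Finset.mem_univ, true_and]
    exact ⟨⟨i, hv⟩, hvD⟩
  have hsurj : Function.Surjective c := by
    intro i
    have h1 := Finset.le_card_sdiff D (P i)
    rw [hP] at h1
    obtain ⟨v, hv⟩ := Finset.card_pos.1 (show 0 < (P i \ D).card by omega)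
    rw [Finset.mem_sdiff] at hv
    exact ⟨⟨v, hmem hv.1 hv.2⟩, hcu _ hv.1⟩
  refine ⟨U, IsConnectedColoring.isRigid (c := c) ?_ hsurj ?_, hU⟩
  · intro i j S hS u v hu hv huS
    have hin (u : (U : Set V)) (hu : c u = i ∨ c u = j) : u.1 ∈ (P i ∪ P j) \ D := by
      rw [Finset.mem_sdiff, Finset.mem_union]
      refine ⟨?_, hUD u⟩
      rcases hu with h | h
      · exact Or.inl (h ▸ hc u)
      · exact Or.inr (h ▸ hc u)
    let T : Finset V := ((P i ∪ P j) \ D).filter fun a => ∃ h : a ∈ (U : Set V), ⟨a, h⟩ ∈ S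
    have hT (w : (U : Set V)) (hw : c w = i ∨ c w = j) : w.1 ∈ T ↔ w ∈ S := by
      simp only [T, Finset.mem_filter, hin w hw, true_and]
      exact ⟨fun ⟨_, h⟩ => h, fun h => ⟨w.2, h⟩⟩
    have hcl : IsClosedBetween G P D i j T := by
      intro a ha b hb haD hbD hab
      have h1 := hcu ⟨a, hmem ha haD⟩ ha
      have h2 := hcu ⟨b, hmem hb hbD⟩ hb
      rw [hT ⟨a, hmem ha haD⟩ (Or.inl h1), hT ⟨b, hmem hb hbD⟩ (Or.inr h2)]
      exact hS _ _ hab h1 h2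
    have huT := (hT u hu).2 huS
    rcases hconn i j T (Finset.filter_subset _ _) hcl with h | h
    · simp [h] at huT
    · exact (hT v hv).1 (h ▸ hin v hv)
  · have : 2 * m ≤ d * m := by gcongr
    have h8 : d * 8 ≤ d * m := by gcongr; omega
    have : Fintype.card ((U : Set V) : Type _) = U.card := by simp
    rw [this]
    have : d * m = 2 * m + (d - 2) * m := by rw [← add_mul]; congr 1; omega
    nlinarith

end Deterministic

theorem exists_isRigidComponent_of_isRigid {V : Type*} [Fintype V] {d : ℕ} {G : SimpleGraph V}
    {U : Finset V} (h : IsRigid d (G.induce (U : Set V))) :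
    ∃ U' : Finset V, IsRigidComponent d G U' ∧ U ⊆ U' := by
  obtain ⟨U', hle, hmax⟩ := (Set.toFinite {W : Finset V | IsRigid d (G.induce (W : Set V))}).exists_le_maximal h
  exact ⟨U', ⟨hmax.prop, fun W hW hr => hmax.not_prop_of_gt hW hr⟩, hle⟩

end RigidComponent

/-! ### Union bounds in the random graph. -/

namespace RigidComponent

open MeasureTheory ProbabilityTheory unitInterval

section Probability

variable {V : Type*} [Finite V] {p : I}

theorem binomialRandom_real_forall_notMem_le (T : Finset (Sym2 V)) (hT : ∀ e ∈ T, ¬ e.IsDiag) :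
    (SimpleGraph.binomialRandom V p).real {G | ∀ e ∈ T, e ∉ G.edgeSet} ≤
      (1 - (p : ℝ)) ^ T.card := by
  have h : SimpleGraph.binomialRandom V p {G | ∀ e ∈ T, e ∉ G.edgeSet} ≤
      ∏ _e ∈ T, (toNNReal (σ p) : ENNReal) := by
    rw [SimpleGraph.binomialRandom_apply]
    calc _ ≤ _ := measure_mono (t := Set.pi (T : Set (Sym2 V)) fun _ => ({False} : Set Prop)) ?_
      _ = _ := Measure.infinitePi_pi _ fun _ _ => trivial
      _ = _ := Finset.prod_congr rfl fun e he => ?_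
    · rintro _ ⟨G, hG, rfl⟩ e he
      simpa using hG e he
    · simp [hT e he]
  rw [Measure.real]
  refine (ENNReal.toReal_mono (by simp) h).trans ?_
  simp

/-- Pairs leaving `D` are determined by their unordered edge, so no edge is counted twice. -/
theorem binomialRandom_real_forall_not_adj_le (D : Finset V) (B : Finset (V × V))
    (hB : ∀ x ∈ B, x.1 ∈ D ∧ x.2 ∉ D) :
    (SimpleGraph.binomialRandom V p).real {G | ∀ x ∈ B, ¬ G.Adj x.1 x.2} ≤
      (1 - (p : ℝ)) ^ B.card := by
  classical
  have hinj : Set.InjOn (fun x : V × V => s(x.1, x.2)) B := by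
    rintro ⟨a, b⟩ hx ⟨a', b'⟩ hy h
    have h1 := hB _ hx
    have h2 := hB _ hy
    rcases Sym2.eq_iff.1 h with ⟨h, h'⟩ | ⟨h, h'⟩
    · exact Prod.ext h h'
    · simp_all
  have := binomialRandom_real_forall_notMem_le (p := p) (B.image fun x => s(x.1, x.2)) (by
    simp only [Finset.mem_image, forall_exists_index, and_imp]
    rintro _ x hx rfl h
    have h1 := hB _ hx
    rw [Sym2.mk_isDiag_iff] at h
    simp_all)
  rw [Finset.card_image_of_injOn hinj] at this
  simpa only [Finset.forall_mem_image, SimpleGraph.mem_edgeSet] using this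

variable {d : ℕ} {P : Fin d → Finset V} {m k : ℕ}

theorem binomialRandom_real_not_joinsLargeSets_le (hP : ∀ i, (P i).card = m) :
    (SimpleGraph.binomialRandom V p).real {G | ¬ JoinsLargeSets G P k} ≤
      (d : ℝ) ^ 2 * 4 ^ m * (1 - (p : ℝ)) ^ (k ^ 2) := by
  classical
  have hp0 : 0 ≤ 1 - (p : ℝ) := by linarith [p.2.2]
  have hp1 : 1 - (p : ℝ) ≤ 1 := by linarith [p.2.1]
  let J : Finset (Σ _ : Fin d × Fin d, Finset V × Finset V) :=
    Finset.univ.sigma fun a => (P a.1).powerset ×ˢ (P a.2).powerset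
  let E : (Σ _ : Fin d × Fin d, Finset V × Finset V) → Set (SimpleGraph V) := fun a =>
    {G | (Disjoint a.2.1 a.2.2 ∧ k ≤ a.2.1.card ∧ k ≤ a.2.2.card) ∧
      ∀ x ∈ a.2.1 ×ˢ a.2.2, ¬ G.Adj x.1 x.2}
  have hsub : {G | ¬ JoinsLargeSets G P k} ⊆ ⋃ a ∈ J, E a := by
    intro G hG
    simp only [Set.mem_ofPred_eq, JoinsLargeSets] at hG
    push Not at hG
    obtain ⟨i, j, X, hX, Y, hY, hXY, hkX, hkY, h⟩ := hG
    simp only [Set.mem_iUnion]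
    refine ⟨⟨(i, j), (X, Y)⟩, by simp [J, hX, hY], ⟨hXY, hkX, hkY⟩, ?_⟩
    rintro ⟨u, v⟩ hx
    rw [Finset.mem_product] at hx
    exact h u hx.1 v hx.2
  have hE (a) : (SimpleGraph.binomialRandom V p).real (E a) ≤ (1 - (p : ℝ)) ^ (k ^ 2) := by
    by_cases h : Disjoint a.2.1 a.2.2 ∧ k ≤ a.2.1.card ∧ k ≤ a.2.2.card
    · have h1 := binomialRandom_real_forall_not_adj_le (p := p) a.2.1 (a.2.1 ×ˢ a.2.2)
        (fun x hx => by
          rw [Finset.mem_product] at hx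
          exact ⟨hx.1, Finset.disjoint_right.1 h.1 hx.2⟩)
      simp only [E, h, true_and, and_self]
      refine h1.trans (pow_le_pow_of_le_one hp0 hp1 ?_)
      rw [Finset.card_product, sq]
      exact Nat.mul_le_mul h.2.1 h.2.2
    · simp only [E, h, false_and]
      simpa using pow_nonneg hp0 _
  calc _ ≤ _ := measureReal_mono hsub (measure_ne_top _ _)
    _ ≤ _ := measureReal_biUnion_finset_le J E
    _ ≤ ∑ _a ∈ J, (1 - (p : ℝ)) ^ (k ^ 2) := Finset.sum_le_sum fun a _ => hE a
    _ = _ := by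
      rw [Finset.sum_const, nsmul_eq_mul]
      congr 1
      simp only [J, Finset.card_sigma, Finset.card_product, Finset.card_powerset, hP]
      simp only [Finset.sum_const, Finset.card_univ, Fintype.card_prod, Fintype.card_fin,
        smul_eq_mul, Nat.cast_mul, Nat.cast_pow, ← mul_pow]
      norm_num
      ring

/-- Coding `(D, τ)` as a map `V → Option (Fin d)` makes the sum over all pairs factor over vertices.
The bound `D.card ≤ 4 * k` leaves each vertex of `D` at least `m - 4 * k` forbidden edges; `2 * k ≤
D.card` enters through `1 ≤ exp (D.card - 2 * k)`. -/
theorem binomialRandom_real_exists_isDetached_le (hP : ∀ i, (P i).card = m) :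
    (SimpleGraph.binomialRandom V p).real {G | ∃ D : Finset V, 2 * k ≤ D.card ∧ D.card ≤ 4 * k ∧
      ∃ τ, IsDetached G P D τ} ≤
      Real.exp (-(2 * k)) * (1 + d * (Real.exp 1 * (1 - (p : ℝ)) ^ (m - 4 * k))) ^ Nat.card V := by
  classical
  have : Fintype V := Fintype.ofFinite V
  have hp0 : 0 ≤ 1 - (p : ℝ) := by linarith [p.2.2]
  have hp1 : 1 - (p : ℝ) ≤ 1 := by linarith [p.2.1]
  set y := (1 - (p : ℝ)) ^ (m - 4 * k)
  have hy : 0 ≤ y := pow_nonneg hp0 _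
  let supp : (V → Option (Fin d)) → Finset V := fun F => Finset.univ.filter fun v => F v ≠ none
  let E : (V → Option (Fin d)) → Set (SimpleGraph V) := fun F =>
    {G | (2 * k ≤ (supp F).card ∧ (supp F).card ≤ 4 * k) ∧
      ∀ v ∈ supp F, ∀ i ∈ F v, ∀ w ∈ P i \ supp F, ¬ G.Adj v w}
  have hsub : {G | ∃ D : Finset V, 2 * k ≤ D.card ∧ D.card ≤ 4 * k ∧
      ∃ τ, IsDetached G P D τ} ⊆ ⋃ F, E F := by
    rintro G ⟨D, h1, h2, τ, hτ⟩
    have hD : supp (fun v => if v ∈ D then some (τ v) else none) = D := by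
      ext v; simp [supp]
    refine Set.mem_iUnion.2 ⟨fun v => if v ∈ D then some (τ v) else none, ?_⟩
    simp only [E, hD, Set.mem_ofPred_eq]
    refine ⟨⟨h1, h2⟩, fun v hv i hi w hw => ?_⟩
    simp only [hv, if_true, Option.mem_def, Option.some.injEq] at hi
    rw [Finset.mem_sdiff, ← hi] at hw
    exact hτ v hv w hw.1 hw.2
  have hE (F) : (SimpleGraph.binomialRandom V p).real (E F) ≤
      Real.exp (-(2 * k)) * ∏ v, (F v).elim 1 fun _ => Real.exp 1 * y := by
    have hprod : ∏ v, ((F v).elim 1 fun _ => Real.exp 1 * y) =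
        (Real.exp 1 * y) ^ (supp F).card := by
      rw [← Finset.prod_const, Finset.prod_filter]
      refine Finset.prod_congr rfl fun v _ => ?_
      cases F v <;> simp
    rw [hprod]
    by_cases h : 2 * k ≤ (supp F).card ∧ (supp F).card ≤ 4 * k
    · let B : Finset (V × V) := Finset.univ.filter fun x =>
        x.1 ∈ supp F ∧ ∃ i ∈ F x.1, x.2 ∈ P i \ supp F
      have hBcard : (m - 4 * k) * (supp F).card ≤ B.card := by
        rw [Finset.card_eq_sum_card_fiberwise (f := Prod.fst) (t := supp F)
          (fun x hx => (Finset.mem_filter.1 hx).2.1), mul_comm, ← smul_eq_mul]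
        refine Finset.card_nsmul_le_sum _ _ _ fun v hv => ?_
        obtain ⟨i, hi⟩ := Option.ne_none_iff_exists'.1 (Finset.mem_filter.1 hv).2
        calc m - 4 * k ≤ (P i).card - (supp F).card := by rw [hP]; omega
          _ ≤ (P i \ supp F).card := Finset.le_card_sdiff _ _
          _ = ((P i \ supp F).image fun w => (v, w)).card :=
            (Finset.card_image_of_injective _ (Prod.mk_right_injective v)).symm
          _ ≤ _ := by
            refine Finset.card_le_card ?_
            intro x hx
            obtain ⟨w, hw, rfl⟩ := Finset.mem_image.1 hx
            simp only [B, Finset.mem_filter, Finset.mem_univ, true_and, and_true]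
            exact ⟨hv, i, hi, hw⟩
      have h1 := binomialRandom_real_forall_not_adj_le (p := p) (supp F) B (fun x hx => by
        obtain ⟨-, hx1, i, hi, hx2⟩ := Finset.mem_filter.1 hx
        exact ⟨hx1, (Finset.mem_sdiff.1 hx2).2⟩)
      calc _ ≤ _ := measureReal_mono (s₂ := {G | ∀ x ∈ B, ¬ G.Adj x.1 x.2}) ?_
        _ ≤ _ := h1
        _ ≤ _ := pow_le_pow_of_le_one hp0 hp1 hBcard
        _ = 1 * y ^ (supp F).card := by rw [pow_mul, one_mul]
        _ ≤ (Real.exp (-(2 * k)) * Real.exp 1 ^ (supp F).card) * y ^ (supp F).card := ?_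
        _ = _ := by rw [mul_pow, mul_assoc]
      · rintro G hG x hx
        obtain ⟨-, hx1, i, hi, hx2⟩ := Finset.mem_filter.1 hx
        exact hG.2 x.1 hx1 i hi x.2 hx2
      · gcongr
        rw [← Real.exp_nat_mul, ← Real.exp_add]
        refine Real.one_le_exp ?_
        have : ((2 * k : ℕ) : ℝ) ≤ (supp F).card := Nat.cast_le.2 h.1
        push_cast at this
        linarith
    · simp only [E, h, false_and]
      simp only [Set.ofPred_false, measureReal_empty]
      positivity
  calc _ ≤ _ := measureReal_mono hsub (measure_ne_top _ _)
    _ ≤ _ := measureReal_iUnion_fintype_le E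
    _ ≤ _ := Finset.sum_le_sum fun F _ => hE F
    _ = _ := by
      rw [← Finset.mul_sum]
      congr 1
      have := Finset.prod_univ_sum (fun _ : V => (Finset.univ : Finset (Option (Fin d))))
        (fun _ o => o.elim (1 : ℝ) fun _ => Real.exp 1 * y)
      rw [Fintype.piFinset_univ] at this
      rw [← this]
      simp [Fintype.sum_option, Nat.card_eq_fintype_card]

end Probability

end RigidComponent

/-! ### Choice of blocks and asymptotic estimates. -/

namespace RigidComponent

open MeasureTheory ProbabilityTheory unitInterval Filter Topology

/-- Consecutive blocks of `m` vertices. -/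
def block (n d m : ℕ) (i : Fin d) : Finset (Fin n) :=
  Finset.univ.filter fun v => v.val / m = i.val

theorem pairwise_disjoint_block (n d m : ℕ) :
    Pairwise fun i j => Disjoint (block n d m i) (block n d m j) := by
  intro i j hij
  rw [Finset.disjoint_left]
  intro v hv hv'
  simp only [block, Finset.mem_filter, Finset.mem_univ, true_and] at hv hv'
  exact hij (Fin.ext (hv.symm.trans hv'))

theorem card_block {n d m : ℕ} (hm : 0 < m) (hn : d * m ≤ n) (i : Fin d) :
    (block n d m i).card = m := by
  have : (block n d m i).map Fin.valEmbedding = Finset.Ico (i.val * m) ((i.val + 1) * m) := by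
    ext a
    have hi : (i.val + 1) * m ≤ d * m := Nat.mul_le_mul_right _ i.2
    simp only [block, Finset.mem_map, Finset.mem_filter, Finset.mem_univ, true_and,
      Fin.valEmbedding_apply, Finset.mem_Ico]
    constructor
    · rintro ⟨v, hv, rfl⟩
      rw [← hv]
      exact ⟨Nat.div_mul_le_self _ _, by rw [mul_comm]; exact Nat.lt_mul_div_succ _ hm⟩
    · rintro ⟨h1, h2⟩
      refine ⟨⟨a, by omega⟩, ?_, rfl⟩
      exact Nat.div_eq_of_lt_le h1 h2
  rw [← Finset.card_map Fin.valEmbedding, this, Nat.card_Ico, add_mul]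
  omega

theorem le_binomialRandom_real_isRigidComponent {n d m k : ℕ} (p : I) (hd : 2 ≤ d)
    (hk : 0 < k) (hkm : 8 * k ≤ m) (hn : d * m ≤ n) :
    1 - ((d : ℝ) ^ 2 * 4 ^ m * (1 - (p : ℝ)) ^ (k ^ 2) +
      Real.exp (-(2 * k)) * (1 + d * (Real.exp 1 * (1 - (p : ℝ)) ^ (m - 4 * k))) ^ n) ≤
    (SimpleGraph.binomialRandom (Fin n) p).real {G | ∃ U : Finset (Fin n),
      IsRigidComponent d G U ∧ d * m ≤ U.card + 2 * k} := by
  set μ := SimpleGraph.binomialRandom (Fin n) p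
  have hP := card_block (n := n) (d := d) (m := m) (by omega) hn
  set P := block n d m
  have h1 := binomialRandom_real_not_joinsLargeSets_le (p := p) (k := k) hP
  have h2 := binomialRandom_real_exists_isDetached_le (p := p) (k := k) hP
  rw [Nat.card_fin] at h2
  set A := {G : SimpleGraph (Fin n) | ∃ U : Finset (Fin n),
      IsRigidComponent d G U ∧ d * m ≤ U.card + 2 * k}
  set B₁ := {G : SimpleGraph (Fin n) | ¬ JoinsLargeSets G P k}
  set B₂ := {G : SimpleGraph (Fin n) | ∃ D : Finset (Fin n), 2 * k ≤ D.card ∧ D.card ≤ 4 * k ∧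
      ∃ τ, IsDetached G P D τ}
  have hcover : Set.univ ⊆ A ∪ (B₁ ∪ B₂) := by
    intro G _
    by_contra hG
    simp only [Set.mem_union, not_or] at hG
    obtain ⟨hA, hB₁, hB₂⟩ := hG
    obtain ⟨U, hU, hcard⟩ := exists_isRigid_induce (G := G) hd (pairwise_disjoint_block n d m) hP
      hk hkm (not_not.1 hB₁) (fun D h h' τ hτ => hB₂ ⟨D, h, h', τ, hτ⟩)
    obtain ⟨U', hU', hle⟩ := exists_isRigidComponent_of_isRigid hU
    exact hA ⟨U', hU', hcard.trans (by gcongr)⟩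
  have h3 : (1 : ℝ) ≤ μ.real A + (μ.real B₁ + μ.real B₂) := by
    calc (1 : ℝ) = μ.real Set.univ := by simp
      _ ≤ _ := measureReal_mono hcover
      _ ≤ _ := measureReal_union_le _ _
      _ ≤ _ := by gcongr; exact measureReal_union_le _ _
  linarith

theorem one_sub_pow_le_exp {p : ℝ} (hp : p ≤ 1) (k : ℕ) : (1 - p) ^ k ≤ Real.exp (-(p * k)) := by
  calc (1 - p) ^ k ≤ Real.exp (-p) ^ k :=
        pow_le_pow_left₀ (by linarith) (Real.one_sub_le_exp_neg p) k
    _ = _ := by rw [← Real.exp_nat_mul]; congr 1; ring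

/-- First term: `p * k ^ 2` exceeds `2 * m`. Second term: `n * z ≤ δ * m / 2`, half of the gain `2 *
k ≥ δ * m`. -/
theorem failure_bound_le {n d m k : ℕ} {p δ : ℝ} (hd : 2 ≤ d) (hp0 : 0 ≤ p) (hp1 : p ≤ 1)
    (hδ0 : 0 < δ) (hδ : δ ≤ 1 / 8) (hm : 0 < m) (hk : δ * m / 2 ≤ k) (hkm : 8 * k ≤ m)
    (hn : n ≤ 2 * d * m) (hp : 50 / δ ^ 2 * Real.log d ≤ p * m) :
    (d : ℝ) ^ 2 * 4 ^ m * (1 - p) ^ (k ^ 2) +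
      Real.exp (-(2 * k)) * (1 + d * (Real.exp 1 * (1 - p) ^ (m - 4 * k))) ^ n ≤
    (d : ℝ) ^ 2 * (4 * Real.exp (-2)) ^ m + Real.exp (-(δ / 2)) ^ m := by
  have hd' : (2 : ℝ) ≤ d := by exact_mod_cast hd
  have hm' : (0 : ℝ) < m := by exact_mod_cast hm
  have hlog : 1 / 2 ≤ Real.log d := by
    have := Real.log_le_log two_pos hd'
    linarith [Real.log_two_gt_d9]
  have hδ2 : 0 < δ ^ 2 := by positivity
  have hpm : 50 * Real.log d ≤ δ ^ 2 * (p * m) := by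
    calc 50 * Real.log d = δ ^ 2 * (50 / δ ^ 2 * Real.log d) := by field_simp
      _ ≤ _ := by gcongr
  gcongr ?_ + ?_
  · rw [mul_pow, ← Real.exp_nat_mul, mul_assoc]
    gcongr
    refine (one_sub_pow_le_exp hp1 _).trans (Real.exp_le_exp.2 ?_)
    have h1 : p * (δ * m / 2) ^ 2 ≤ p * (k : ℝ) ^ 2 := by gcongr
    have h2 : 25 * (m : ℝ) ≤ δ ^ 2 * (p * m) * m := by
      gcongr
      linarith
    push_cast
    nlinarith
  · have hkm' : 8 * (k : ℝ) ≤ m := by exact_mod_cast hkm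
    have hcast : ((m - 4 * k : ℕ) : ℝ) = m - 4 * k := by
      rw [Nat.cast_sub (by omega)]; push_cast; ring
    set z := d * (Real.exp 1 * (1 - p) ^ (m - 4 * k))
    have hz0 : 0 ≤ z := by
      have : 0 ≤ 1 - p := by linarith
      positivity
    have hdexp : (d : ℝ) = Real.exp (Real.log d) := (Real.exp_log (by linarith)).symm
    have hpow : (1 - p) ^ (m - 4 * k) ≤ Real.exp (-(25 / δ ^ 2 * Real.log d)) := by
      refine (one_sub_pow_le_exp hp1 _).trans (Real.exp_le_exp.2 ?_)
      rw [hcast]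
      have : p * (m / 2) ≤ p * (m - 4 * k) := by gcongr; linarith
      have : 25 / δ ^ 2 * Real.log d = 50 / δ ^ 2 * Real.log d / 2 := by ring
      linarith
    have hzd : z * (2 * d) ≤ δ / 2 := by
      have hδlog : Real.exp (-(1 / δ)) ≤ δ := by
        rw [Real.exp_neg]
        refine inv_le_of_inv_le₀ hδ0 ?_
        have := Real.add_one_le_exp (1 / δ)
        rw [inv_eq_one_div]
        linarith
      have h8 : 8 ≤ 1 / δ := by rw [le_div_iff₀ hδ0]; linarith
      -- The large multiple of `log d` absorbs both factors `d`, leaving `exp (-(1 / δ)) ≤ δ` and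
      -- `exp (-3) ≤ 1 / 4`.
      have hexp : Real.log d + (1 + -(25 / δ ^ 2 * Real.log d)) + Real.log d ≤
          -(1 / δ) - 3 := by
        have h25 : 25 / δ ^ 2 = 25 * (1 / δ) ^ 2 := by ring
        rw [h25]
        set r := 1 / δ
        have : (25 * r ^ 2 - 2) * (1 / 2) ≤ (25 * r ^ 2 - 2) * Real.log d := by
          gcongr
          nlinarith
        nlinarith
      calc z * (2 * d) ≤ (d * (Real.exp 1 * Real.exp (-(25 / δ ^ 2 * Real.log d)))) * (2 * d) := by
            simp only [z]; gcongr
        _ = 2 * Real.exp (Real.log d + (1 + -(25 / δ ^ 2 * Real.log d)) + Real.log d) := by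
            rw [Real.exp_add, Real.exp_add, Real.exp_add, ← hdexp]; ring
        _ ≤ 2 * Real.exp (-(1 / δ) - 3) := by gcongr
        _ = 2 * (Real.exp (-(1 / δ)) * Real.exp (-3)) := by rw [← Real.exp_add]; rfl
        _ ≤ 2 * (δ * (1 / 4)) := by
            gcongr
            rw [Real.exp_neg, inv_eq_one_div]
            have := Real.add_one_le_exp (3 : ℝ)
            gcongr
            linarith
        _ = δ / 2 := by ring
    calc Real.exp (-(2 * k)) * (1 + z) ^ n ≤ Real.exp (-(2 * k)) * Real.exp z ^ n := by
          gcongr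
          linarith [Real.add_one_le_exp z]
      _ = Real.exp (-(2 * k) + n * z) := by rw [← Real.exp_nat_mul, Real.exp_add]
      _ ≤ Real.exp (m * (-(δ / 2))) := by
          refine Real.exp_le_exp.2 ?_
          have hn' : (n : ℝ) ≤ 2 * d * m := by exact_mod_cast hn
          have h1 : n * z ≤ 2 * d * m * z := by gcongr
          have h2 : (z * (2 * d)) * m ≤ δ / 2 * m := by gcongr
          nlinarith
      _ = _ := Real.exp_nat_mul _ _

theorem tendsto_failure_bound {d : ℕ} (hd : 2 ≤ d) {δ : ℝ} (hδ : 0 < δ) :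
    Tendsto (fun n : ℕ => (d : ℝ) ^ 2 * (4 * Real.exp (-2)) ^ (n / d) +
      Real.exp (-(δ / 2)) ^ (n / d)) atTop (𝓝 0) := by
  have hdiv : Tendsto (fun n : ℕ => n / d) atTop atTop := Nat.tendsto_div_const_atTop (by omega)
  have h1 : 4 * Real.exp (-2) < 1 := by
    have h : 2 * 2 < Real.exp 1 * Real.exp 1 := by
      have := Real.exp_one_gt_d9
      gcongr <;> linarith
    rw [← Real.exp_add] at h
    rw [Real.exp_neg, ← div_eq_mul_inv, div_lt_one (Real.exp_pos _)]
    norm_num at h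
    exact h
  have h2 : Real.exp (-(δ / 2)) < 1 := by
    rw [Real.exp_lt_one_iff]; linarith
  have h3 := ((tendsto_pow_atTop_nhds_zero_of_lt_one (by positivity) h1).const_mul
    ((d : ℝ) ^ 2)).add (tendsto_pow_atTop_nhds_zero_of_lt_one (Real.exp_pos _).le h2)
  rw [mul_zero, add_zero] at h3
  exact h3.comp hdiv

end RigidComponent

/-- The edge probability is `C d log d / n`, truncated to `[0, 1]`; the truncation only acts for
the finitely many `n < C d log d`. -/
theorem theorem1p10 (ε : ℝ) (hε : ε ∈ Set.Ioo (0 : ℝ) 1) :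
    ∃ C : ℝ, 0 < C ∧ ∀ d : ℕ, 2 ≤ d →
      Filter.Tendsto
        (fun n : ℕ =>
          SimpleGraph.binomialRandom (Fin n)
            (Set.projIcc (0 : ℝ) 1 zero_le_one (C * d * Real.log d / n))
            {G : SimpleGraph (Fin n) | ∃ U : Finset (Fin n),
              RigidComponent.IsRigidComponent d G U ∧ (1 - ε) * (n : ℝ) ≤ (U.card : ℝ)})
        Filter.atTop (nhds 1) := by
  obtain ⟨hε0, hε1⟩ := hε
  -- Deleting `2 * k ≤ 2 * δ * n` vertices costs at most `ε * n / 4`, and `δ ≤ 1 / 8` yields `8 * k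
  -- ≤ m`.
  set δ : ℝ := ε / 8 with hδ
  have hδ0 : 0 < δ := by positivity
  have hδ1 : δ ≤ 1 / 8 := by linarith
  -- Since `n ≤ 2 * d * m`, this gives `p * m ≥ 50 / δ ^ 2 * log d`, with a constant independent of
  -- `d`.
  refine ⟨100 / δ ^ 2, by positivity, fun d hd => ?_⟩
  have hd' : (2 : ℝ) ≤ d := by exact_mod_cast hd
  have hlog : 0 < Real.log d := Real.log_pos (by linarith)
  set K : ℝ := 100 / δ ^ 2 * d * Real.log d with hK
  have hK0 : 0 < K := by positivity
  set p : ℕ → unitInterval := fun n => Set.projIcc (0 : ℝ) 1 zero_le_one (K / n) with hp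
  have hlow := (RigidComponent.tendsto_failure_bound hd hδ0).const_sub 1
  rw [sub_zero] at hlow
  have hreal : Filter.Tendsto (fun n : ℕ => (SimpleGraph.binomialRandom (Fin n) (p n)).real
      {G : SimpleGraph (Fin n) | ∃ U : Finset (Fin n),
        RigidComponent.IsRigidComponent d G U ∧ (1 - ε) * (n : ℝ) ≤ (U.card : ℝ)})
      Filter.atTop (nhds 1) := by
    refine tendsto_of_tendsto_of_tendsto_of_le_of_le' hlow tendsto_const_nhds ?_
      (Filter.Eventually.of_forall fun n => MeasureTheory.measureReal_le_one)
    have hdiv : Filter.Tendsto (fun n : ℕ => ((n / d : ℕ) : ℝ)) Filter.atTop Filter.atTop :=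
      tendsto_natCast_atTop_atTop.comp (Nat.tendsto_div_const_atTop (by omega))
    -- These thresholds ensure in turn `k ≥ δ * m / 2` despite the floor, an untruncated edge
    -- probability, and at most `ε * n / 2` vertices outside the blocks.
    filter_upwards [hdiv.eventually_ge_atTop (2 / δ),
      tendsto_natCast_atTop_atTop.eventually_ge_atTop K,
      tendsto_natCast_atTop_atTop.eventually_ge_atTop (2 * d / ε)] with n hm hnK hnε
    have hn0 : (0 : ℝ) < n := hK0.trans_le hnK
    set m := n / d
    have hpn : (p n : ℝ) = K / n := by
      have : K / n ∈ Set.Icc (0 : ℝ) 1 := ⟨by positivity, (div_le_one hn0).2 hnK⟩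
      simp [hp, Set.projIcc_of_mem zero_le_one this]
    have hδm : 2 ≤ δ * m := by rwa [div_le_iff₀' hδ0] at hm
    have hm0 : 0 < m := by
      rcases Nat.eq_zero_or_pos m with h | h
      · rw [h] at hδm; norm_num at hδm
      · exact h
    have hdm : d * m ≤ n := Nat.mul_div_le n d
    have hdm' : n ≤ d * m + d := by
      have := Nat.div_add_mod n d
      have := Nat.mod_lt n (show 0 < d by omega)
      change n ≤ d * (n / d) + d
      omega
    set k := ⌊δ * m⌋₊
    have hkle : (k : ℝ) ≤ δ * m := Nat.floor_le (by positivity)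
    have hkge : δ * m < k + 1 := Nat.lt_floor_add_one _
    have hk0 : 0 < k := Nat.floor_pos.2 (by linarith)
    have hm0' : (0 : ℝ) < m := by exact_mod_cast hm0
    have hkm : 8 * k ≤ m := by
      have : 8 * (k : ℝ) ≤ m := by nlinarith
      exact_mod_cast this
    have hn2 : n ≤ 2 * d * m := by nlinarith
    have hpm : 50 / δ ^ 2 * Real.log d ≤ p n * m := by
      have h1 : (n : ℝ) ≤ 2 * d * m := by exact_mod_cast hn2
      rw [hpn, div_mul_eq_mul_div K, le_div_iff₀ hn0]
      calc 50 / δ ^ 2 * Real.log d * n ≤ 50 / δ ^ 2 * Real.log d * (2 * d * m) := by gcongr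
        _ = K * m := by rw [hK]; ring
    have hbound := RigidComponent.failure_bound_le hd (p n).2.1 (p n).2.2 hδ0 hδ1 hm0
      (by linarith) hkm hn2 hpm
    have hprob := RigidComponent.le_binomialRandom_real_isRigidComponent (p n) hd hk0 hkm hdm
    refine (sub_le_sub_left hbound 1).trans (hprob.trans (MeasureTheory.measureReal_mono ?_))
    rintro G ⟨U, hU, hcard⟩
    refine ⟨U, hU, ?_⟩
    have h1 : (d : ℝ) * m ≤ U.card + 2 * k := by exact_mod_cast hcard
    have h2 : (n : ℝ) ≤ d * m + d := by exact_mod_cast hdm'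
    have h3 : (d : ℝ) * m ≤ n := by exact_mod_cast hdm
    rw [div_le_iff₀ hε0] at hnε
    have h4 : (k : ℝ) ≤ δ * n := by
      refine hkle.trans ?_
      gcongr
      nlinarith
    rw [hδ] at h4
    nlinarith
  have := ENNReal.tendsto_ofReal hreal
  simpa using this
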